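/- Let $K\to R$ be a homomorphism of commutative rings, let $U$ and $V$ be $R$-modules, and let $R\to S$ be a flat epimorphism of commutative rings, i.e., an epimorphism in the category of commutative rings such that $S$ is a flat $R$-module. For a commutative $K$-algebra $A$ and $A$-modules $M$, $N$, a $K$-linear map $e\colon M\to N$ is called a $K$-linear $A$-differential operator if for every $a\in A$ there is an integer $n\ge 0$ (possibly depending on $a$) with $(\theta_a)^{n+1}(e)=0$, where $\theta_a\colon\operatorname{Hom}_K(M,N)\to\operatorname{Hom}_K(M,N)$ is given by $\theta_a(e)(m)=a\,e(m)-e(am)$. Then for every $K$-linear $R$-differential operator $D_R\colon U\to V$ there exists a unique $K$-linear $S$-differential operator $D_S\colon S\otimes_R U\to S\otimes_R V$ such that $D_S(1\otimes u)=1\otimes D_R(u)$ for all $u\in U$. -/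

import Mathlib

open scoped TensorProduct

section DiffOp

variable {K A M N : Type*} [CommRing K] [CommRing A] [Algebra K A]
  [AddCommGroup M] [Module K M] [Module A M] [IsScalarTower K A M]
  [AddCommGroup N] [Module K N] [Module A N] [IsScalarTower K A N]

/-- The commutator `θ_a(e) = a ∘ e - e ∘ a` of a `K`-linear map `e : M → N` with the
multiplication by `a : A`, as a `K`-linear endomorphism of `Hom_K(M, N)`. -/
def diffTheta (K : Type*) {A : Type*} (M N : Type*) [CommRing K] [CommRing A] [Algebra K A]
    [AddCommGroup M] [Module K M] [Module A M] [IsScalarTower K A M]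
    [AddCommGroup N] [Module K N] [Module A N] [IsScalarTower K A N]
    (a : A) : Module.End K (M →ₗ[K] N) where
  toFun e := Algebra.lsmul K K N a ∘ₗ e - e ∘ₗ Algebra.lsmul K K M a
  map_add' e f := by
    ext m
    simp only [LinearMap.sub_apply, LinearMap.add_apply, LinearMap.comp_apply, map_add]
    abel
  map_smul' c e := by
    ext m
    simp only [LinearMap.sub_apply, LinearMap.smul_apply, LinearMap.comp_apply, map_smul,
      RingHom.id_apply, smul_sub]

@[simp]
theorem diffTheta_apply (a : A) (e : M →ₗ[K] N) (m : M) :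
    diffTheta K M N a e m = a • e m - e (a • m) := rfl

/-- `e : M → N` is a `K`-linear `A`-differential operator (of possibly no order): for every
`a : A` it has some finite `a`-order `≤ n`, that is, `θ_a ^ (n + 1)` kills `e`. The integer `n`
may depend on `a`. -/
def IsDiffOp (A : Type*) {K M N : Type*} [CommRing K] [CommRing A] [Algebra K A]
    [AddCommGroup M] [Module K M] [Module A M] [IsScalarTower K A M]
    [AddCommGroup N] [Module K N] [Module A N] [IsScalarTower K A N]
    (e : M →ₗ[K] N) : Prop :=
  ∀ a : A, ∃ n : ℕ, (diffTheta K M N a ^ (n + 1)) e = 0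

end DiffOp

/-!
A `K`-linear map `E : U → W` generates a cyclic module over `S ⊗[K] R` in `Hom_K(U, W)`, where `W` is
an `S`-module, and `E` is an `R`-differential operator exactly when all `a ⊗ 1 - 1 ⊗ a`, for `a : R`,
are nilpotent in the commutative ring `A = (S ⊗[K] R) ⧸ Ann(E)`. In other words, the two structure
maps of `A`, the left one from `S` and the right one from `R`, agree on `R` up to nilpotents.

The point is that the right structure map `R → A` then extends to some `ρ : S → A`
(`exists_ringHom_comp_algebraMap_eq`). Indeed `A ⊗[R] S`, formed with the right structure, is flat
over `A`, and its fibre at a maximal ideal of `A` can be computed with the left structure, which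
factors through `S`; so it is nonzero. Thus `A → A ⊗[R] S` is a faithfully flat epimorphism, that is,
an isomorphism. No finiteness is needed, which is why the order of an operator may depend on `a`.

For existence, `W = S ⊗[R] V` and `E(u) = 1 ⊗ D(u)`; the extension is `s ⊗ u ↦ (ρ(s) E)(u)`
(`IsDiffOp.exists_extension`). It is an `S`-differential operator because the left structure map and
`ρ` coincide modulo the nilradical on `R`, hence on `S`.

For uniqueness, let `D` be the difference of two extensions and replace `S ⊗[K] R` by `S ⊗[K] S`. The
extension property, applied to the image of `S ⊗[K] R` in `(S ⊗[K] S) ⧸ Ann(D)`, shows that this image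
contains every `1 ⊗ s`. So `D` is determined by its values on the elements `1 ⊗ u`, where it vanishes
(`IsDiffOp.eq_zero_of_forall_one_tmul`).
-/

/-! ### Flat epimorphisms of commutative rings -/

theorem Algebra.IsEpi.ringHom_ext {R S C : Type*} [CommRing R] [CommRing S] [CommRing C]
    [Algebra R S] [Algebra.IsEpi R S] {f g : S →+* C}
    (h : f.comp (algebraMap R S) = g.comp (algebraMap R S)) : f = g := by
  let _ : Algebra R C := (f.comp (algebraMap R S)).toAlgebra
  let f' : S →ₐ[R] C := { f with commutes' := fun _ => rfl }
  let g' : S →ₐ[R] C := { g with commutes' := fun a => (RingHom.congr_fun h a).symm }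
  ext s
  have := congrArg (Algebra.TensorProduct.lift f' g' fun _ _ => Commute.all _ _)
    ((Algebra.isEpi_iff_forall_one_tmul_eq R S).mp inferInstance s)
  simp only [Algebra.TensorProduct.lift_tmul, map_one, one_mul, mul_one] at this
  exact this.symm

theorem Algebra.IsEpi.baseChange (R S A : Type*) [CommRing R] [CommRing S] [CommRing A]
    [Algebra R S] [Algebra R A] [Algebra.IsEpi R S] : Algebra.IsEpi A (A ⊗[R] S) := by
  let B := A ⊗[R] S
  have h : (Algebra.TensorProduct.includeRight : B →ₐ[A] B ⊗[A] B) =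
      Algebra.TensorProduct.includeLeft := by
    refine Algebra.TensorProduct.ext (by ext) (AlgHom.coe_ringHom_injective ?_)
    refine Algebra.IsEpi.ringHom_ext (R := R) ?_
    ext a
    simp
  exact (Algebra.isEpi_iff_forall_one_tmul_eq _ _).mpr fun b => AlgHom.congr_fun h b

/-- A faithfully flat epimorphism is an isomorphism: after base change along itself, its structure
map becomes `B → B ⊗[A] B`, which is surjective. -/
theorem Algebra.IsEpi.bijective_algebraMap_of_faithfullyFlat (A B : Type*) [CommRing A]
    [CommRing B] [Algebra A B] [Algebra.IsEpi A B] [Module.FaithfullyFlat A B] :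
    Function.Bijective (algebraMap A B) := by
  refine ⟨FaithfulSMul.algebraMap_injective A B, ?_⟩
  suffices Function.Surjective (Algebra.linearMap A B) from this
  rw [← Module.FaithfullyFlat.lTensor_surjective_iff_surjective A B]
  intro x
  induction x with
  | zero => exact ⟨0, map_zero _⟩
  | add x y hx hy =>
    obtain ⟨x, rfl⟩ := hx
    obtain ⟨y, rfl⟩ := hy
    exact ⟨x + y, map_add _ _ _⟩
  | tmul b c =>
    refine ⟨(b * c) ⊗ₜ 1, ?_⟩
    have h := congrArg (b ⊗ₜ[A] (1 : B) * ·)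
      ((Algebra.isEpi_iff_forall_one_tmul_eq A B).mp inferInstance c)
    simpa using h.symm

section Extension

variable {R S A : Type*} [CommRing R] [CommRing S] [CommRing A] [Algebra R S]

/-- If an `R`-algebra structure on `A` agrees, up to nilpotents, with one that factors through the
flat `R`-algebra `S`, then `A ⊗[R] S` is faithfully flat over `A`: modulo a maximal ideal `m` of `A`
the two structures coincide, so `S` maps to `A ⧸ m` over `R` and the fibre at `m` is nonzero. -/
theorem faithfullyFlat_baseChange_of_isNilpotent_sub [Algebra R A] [Module.Flat R S]
    (l : S →+* A) (h : ∀ a, IsNilpotent (l (algebraMap R S a) - algebraMap R A a)) :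
    Module.FaithfullyFlat A (A ⊗[R] S) where
  submodule_ne_top m hm htop := by
    have hcomm (a : R) : Ideal.Quotient.mk m (l (algebraMap R S a)) =
        algebraMap R (A ⧸ m) a := by
      have := ((h a).map (Ideal.Quotient.mk m)).eq_zero
      rwa [map_sub, sub_eq_zero] at this
    let l' : S →ₐ[R] A ⧸ m := { (Ideal.Quotient.mk m).comp l with commutes' := hcomm }
    let g : A ⊗[R] S →ₐ[A] A ⧸ m :=
      Algebra.TensorProduct.lift (Algebra.ofId A _) l' fun _ _ => Commute.all _ _
    have hg (x : A ⊗[R] S) (hx : x ∈ m • (⊤ : Submodule A (A ⊗[R] S))) : g x = 0 := by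
      induction hx using Submodule.smul_induction_on' with
      | smul a ha y _ =>
        rw [map_smul, Algebra.smul_def, Ideal.Quotient.algebraMap_eq,
          Ideal.Quotient.eq_zero_iff_mem.mpr ha, zero_mul]
      | add x _ y _ hx hy => rw [map_add, hx, hy, add_zero]
    exact one_ne_zero ((map_one g).symm.trans (hg 1 (htop.ge Submodule.mem_top)))

/-- A ring homomorphism `r : R → A` extends along the flat epimorphism `R → S` as soon as it agrees,
up to nilpotents, with one that does: `A → A ⊗[R] S` is a faithfully flat epimorphism, hence an
isomorphism. -/
theorem exists_ringHom_comp_algebraMap_eq [Module.Flat R S] [Algebra.IsEpi R S]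
    (l : S →+* A) (r : R →+* A) (h : ∀ a, IsNilpotent (l (algebraMap R S a) - r a)) :
    ∃ ρ : S →+* A, ρ.comp (algebraMap R S) = r := by
  let _ : Algebra R A := r.toAlgebra
  have := faithfullyFlat_baseChange_of_isNilpotent_sub (R := R) l h
  have := Algebra.IsEpi.baseChange R S A
  let e : A ≃+* A ⊗[R] S := RingEquiv.ofBijective (algebraMap A (A ⊗[R] S))
    (Algebra.IsEpi.bijective_algebraMap_of_faithfullyFlat A (A ⊗[R] S))
  refine ⟨(e.symm : A ⊗[R] S →+* A).comp
    (Algebra.TensorProduct.includeRight : S →ₐ[R] A ⊗[R] S), ?_⟩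
  ext a
  refine (e.symm_apply_eq).mpr ?_
  exact (AlgHom.commutes (Algebra.TensorProduct.includeRight : S →ₐ[R] A ⊗[R] S) a).trans
    (IsScalarTower.algebraMap_apply R A (A ⊗[R] S) a)

/-- Two homomorphisms on `S` that agree on `R` up to nilpotents agree on `S` up to nilpotents, as
they coincide on `R` modulo the nilradical. -/
theorem isNilpotent_sub_of_isEpi [Algebra.IsEpi R S] (l ρ : S →+* A)
    (h : ∀ a, IsNilpotent (l (algebraMap R S a) - ρ (algebraMap R S a))) (s : S) :
    IsNilpotent (l s - ρ s) := by
  have key : (Ideal.Quotient.mk (nilradical A)).comp l =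
      (Ideal.Quotient.mk (nilradical A)).comp ρ :=
    Algebra.IsEpi.ringHom_ext (R := R) <| RingHom.ext fun a =>
      Ideal.Quotient.eq.mpr (mem_nilradical.mpr (h a))
  exact mem_nilradical.mp (Ideal.Quotient.eq.mp (RingHom.congr_fun key s))

/-- If `l(S)` and `ρ(R)` lie in a subring, then so does `ρ(S)`: the extension of `ρ|_R` to `S` exists
already inside the subring, and it is `ρ` because `R → S` is an epimorphism. -/
theorem map_mem_subring_of_isEpi [Module.Flat R S] [Algebra.IsEpi R S] (A' : Subring A)
    (l ρ : S →+* A) (h : ∀ a, IsNilpotent (l (algebraMap R S a) - ρ (algebraMap R S a)))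
    (hl : ∀ s, l s ∈ A') (hρ : ∀ a, ρ (algebraMap R S a) ∈ A') (s : S) : ρ s ∈ A' := by
  obtain ⟨ρ', hρ'⟩ := exists_ringHom_comp_algebraMap_eq (l.codRestrict A' hl)
    ((ρ.comp (algebraMap R S)).codRestrict A' hρ)
    fun a => (IsNilpotent.map_iff A'.subtype_injective).mp (by simpa using h a)
  have : A'.subtype.comp ρ' = ρ := by
    refine Algebra.IsEpi.ringHom_ext (R := R) ?_
    rw [RingHom.comp_assoc, hρ']
    rfl
  rw [← this]
  exact (ρ' s).2

end Extension

/-! ### The bimodule structure on `K`-linear maps -/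

section Action

/-- The action of `B` on `Hom_K(M, W)` by precomposition, for a `B`-module `M`. -/
def precompAction (K B M W : Type*) [CommRing K] [CommRing B] [Algebra K B]
    [AddCommGroup M] [Module K M] [Module B M] [IsScalarTower K B M]
    [AddCommGroup W] [Module K W] : B →ₐ[K] Module.End K (M →ₗ[K] W) where
  toFun b := LinearMap.lcomp K W (Algebra.lsmul K K M b)
  map_one' := by ext; simp
  map_mul' x y := by ext; simp [mul_comm x y]
  map_zero' := by ext; simp
  map_add' x y := by ext; simp
  commutes' k := by ext; simp

/-- The action of `S ⊗[K] B` on `Hom_K(M, W)`, for an `S`-module `W` and a `B`-module `M`, given by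
`((s ⊗ b) e)(m) = s e(b m)`. -/
noncomputable def homAction (K S B M W : Type*) [CommRing K] [CommRing S] [CommRing B]
    [Algebra K S] [Algebra K B] [AddCommGroup M] [Module K M] [Module B M] [IsScalarTower K B M]
    [AddCommGroup W] [Module K W] [Module S W] [IsScalarTower K S W] :
    S ⊗[K] B →ₐ[K] Module.End K (M →ₗ[K] W) :=
  Algebra.TensorProduct.lift (Algebra.lsmul K K (M →ₗ[K] W)) (precompAction K B M W)
    fun s b => by ext; simp [precompAction]

variable {K S B M W : Type*} [CommRing K] [CommRing S] [CommRing B] [Algebra K S] [Algebra K B]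
  [AddCommGroup M] [Module K M] [Module B M] [IsScalarTower K B M]
  [AddCommGroup W] [Module K W] [Module S W] [IsScalarTower K S W]

@[simp]
theorem homAction_tmul_apply (s : S) (b : B) (e : M →ₗ[K] W) (m : M) :
    homAction K S B M W (s ⊗ₜ b) e m = s • e (b • m) := by
  simp [homAction, precompAction]

/-- The element `b ⊗ 1 - 1 ⊗ b` acts as the commutator `θ_b`, so differential operators are the
elements of `Hom_K(M, W)` on which all these elements are locally nilpotent. -/
theorem homAction_sub_eq_diffTheta [Algebra B S] [Module B W] [IsScalarTower B S W]
    [IsScalarTower K B W] (b : B) :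
    homAction K S B M W (algebraMap B S b ⊗ₜ 1 - 1 ⊗ₜ b) = diffTheta K M W b := by
  ext e m
  simp

/-- The annihilator of a `K`-linear map under the action of `S ⊗[K] B`. -/
noncomputable def homAnnihilator (S B : Type*) {K M W : Type*} [CommRing K] [CommRing S]
    [CommRing B] [Algebra K S] [Algebra K B] [AddCommGroup M] [Module K M] [Module B M]
    [IsScalarTower K B M] [AddCommGroup W] [Module K W] [Module S W] [IsScalarTower K S W]
    (E : M →ₗ[K] W) : Ideal (S ⊗[K] B) where
  carrier := {c | homAction K S B M W c E = 0}
  add_mem' {x y} hx hy := by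
    change homAction K S B M W (x + y) E = 0
    change homAction K S B M W x E = 0 at hx
    change homAction K S B M W y E = 0 at hy
    rw [map_add, LinearMap.add_apply, hx, hy, add_zero]
  zero_mem' := by simp
  smul_mem' c x hx := by
    change homAction K S B M W (c • x) E = 0
    change homAction K S B M W x E = 0 at hx
    rw [smul_eq_mul, map_mul, Module.End.mul_apply, hx, map_zero]

theorem mem_homAnnihilator {E : M →ₗ[K] W} {c : S ⊗[K] B} :
    c ∈ homAnnihilator S B E ↔ homAction K S B M W c E = 0 := Iff.rfl

/-- The embedding of the cyclic module `(S ⊗[K] B) ⧸ Ann(E)` into `Hom_K(M, W)` that sends `1`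
to `E`. -/
noncomputable def homEval (E : M →ₗ[K] W) : (S ⊗[K] B ⧸ homAnnihilator S B E) →+ (M →ₗ[K] W) :=
  QuotientAddGroup.lift (homAnnihilator S B E).toAddSubgroup
    (((LinearMap.applyₗ (R := K) E).comp (homAction K S B M W).toLinearMap).toAddMonoidHom)
    fun _ hx => hx

theorem homEval_mk (E : M →ₗ[K] W) (c : S ⊗[K] B) :
    homEval E (Ideal.Quotient.mk (homAnnihilator S B E) c) = homAction K S B M W c E := rfl

theorem homEval_mk_mul (E : M →ₗ[K] W) (c : S ⊗[K] B) (x : S ⊗[K] B ⧸ homAnnihilator S B E) :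
    homEval E (Ideal.Quotient.mk _ c * x) = homAction K S B M W c (homEval E x) := by
  obtain ⟨x, rfl⟩ := Ideal.Quotient.mk_surjective x
  rw [← map_mul, homEval_mk, homEval_mk, map_mul, Module.End.mul_apply]

/-- The left structure map `S → (S ⊗[K] B) ⧸ Ann(E)`. -/
noncomputable def homLeft (E : M →ₗ[K] W) : S →+* S ⊗[K] B ⧸ homAnnihilator S B E :=
  (Ideal.Quotient.mk _).comp Algebra.TensorProduct.includeLeftRingHom

/-- The right structure map `B → (S ⊗[K] B) ⧸ Ann(E)`. -/
noncomputable def homRight (E : M →ₗ[K] W) : B →+* S ⊗[K] B ⧸ homAnnihilator S B E :=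
  (Ideal.Quotient.mk _).comp
    ((Algebra.TensorProduct.includeRight : B →ₐ[K] S ⊗[K] B) : B →+* S ⊗[K] B)

theorem homEval_homLeft_mul_apply (E : M →ₗ[K] W) (s : S)
    (x : S ⊗[K] B ⧸ homAnnihilator S B E) (m : M) :
    homEval E (homLeft E s * x) m = s • homEval E x m := by
  refine (LinearMap.congr_fun (homEval_mk_mul E (s ⊗ₜ 1) x) m).trans ?_
  rw [homAction_tmul_apply, one_smul]

theorem homEval_homRight_mul_apply (E : M →ₗ[K] W) (b : B)
    (x : S ⊗[K] B ⧸ homAnnihilator S B E) (m : M) :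
    homEval E (homRight E b * x) m = homEval E x (b • m) := by
  refine (LinearMap.congr_fun (homEval_mk_mul E (1 ⊗ₜ b) x) m).trans ?_
  rw [homAction_tmul_apply, one_smul]

theorem IsDiffOp.isNilpotent_homLeft_sub_homRight [Algebra B S] [Module B W] [IsScalarTower B S W]
    [IsScalarTower K B W] {E : M →ₗ[K] W} (hE : IsDiffOp B E) (b : B) :
    IsNilpotent (homLeft E (algebraMap B S b) - homRight E b) := by
  obtain ⟨n, hn⟩ := hE b
  refine ⟨n + 1, ?_⟩
  have : homLeft E (algebraMap B S b) - homRight E b =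
      Ideal.Quotient.mk (homAnnihilator S B E) (algebraMap B S b ⊗ₜ 1 - 1 ⊗ₜ b) := rfl
  rw [this, ← map_pow, Ideal.Quotient.eq_zero_iff_mem, mem_homAnnihilator, map_pow,
    homAction_sub_eq_diffTheta, hn]

end Action

/-! ### Closure properties of differential operators -/

section DiffOp

variable {K A M N : Type*} [CommRing K] [CommRing A] [Algebra K A]
  [AddCommGroup M] [Module K M] [Module A M] [IsScalarTower K A M]
  [AddCommGroup N] [Module K N] [Module A N] [IsScalarTower K A N]

theorem IsDiffOp.sub {e f : M →ₗ[K] N} (he : IsDiffOp A e) (hf : IsDiffOp A f) :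
    IsDiffOp A (e - f) := by
  intro a
  obtain ⟨m, hm⟩ := he a
  obtain ⟨n, hn⟩ := hf a
  have key {g : M →ₗ[K] N} {k p : ℕ} (hg : (diffTheta K M N a ^ (k + 1)) g = 0) (h : k ≤ p) :
      (diffTheta K M N a ^ (p + 1)) g = 0 :=
    Module.End.pow_map_zero_of_le (Nat.succ_le_succ h) hg
  refine ⟨max m n, ?_⟩
  rw [map_sub, key hm (le_max_left m n), key hn (le_max_right m n), sub_zero]

theorem IsDiffOp.comp_left {P : Type*} [AddCommGroup P] [Module K P] [Module A P]
    [IsScalarTower K A P] {e : M →ₗ[K] N} (he : IsDiffOp A e) (f : N →ₗ[K] P)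
    (hf : ∀ (a : A) (x : N), f (a • x) = a • f x) : IsDiffOp A (f ∘ₗ e) := by
  intro a
  obtain ⟨n, hn⟩ := he a
  have key (k : ℕ) : (diffTheta K M P a ^ k) (f ∘ₗ e) = f ∘ₗ (diffTheta K M N a ^ k) e := by
    induction k with
    | zero => rfl
    | succ k ih =>
      rw [pow_succ', pow_succ', Module.End.mul_apply, Module.End.mul_apply, ih]
      ext m
      simp [hf]
  exact ⟨n, by rw [key, hn, LinearMap.comp_zero]⟩

end DiffOp

/-! ### Extension of differential operators along a flat epimorphism -/

section FlatEpi

variable {K R S : Type*} [CommRing K] [CommRing R] [CommRing S]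
  [Algebra K R] [Algebra R S] [Algebra K S] [IsScalarTower K R S]
  [Module.Flat R S] [Algebra.IsEpi R S]

/-- A `K`-linear `R`-differential operator `E : U → W` into an `S`-module extends to the
`S`-differential operator `s ⊗ u ↦ (ρ(s) E)(u)`, where `ρ` extends the right structure map of
`(S ⊗[K] R) ⧸ Ann(E)` from `R` to `S`. -/
theorem IsDiffOp.exists_extension {U W : Type*}
    [AddCommGroup U] [Module K U] [Module R U] [IsScalarTower K R U]
    [AddCommGroup W] [Module K W] [Module R W] [IsScalarTower K R W]
    [Module S W] [IsScalarTower K S W] [IsScalarTower R S W]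
    {E : U →ₗ[K] W} (hE : IsDiffOp R E) :
    ∃ D : S ⊗[R] U →ₗ[K] W, IsDiffOp S D ∧ ∀ u, D ((1 : S) ⊗ₜ[R] u) = E u := by
  obtain ⟨ρ, hρ⟩ := exists_ringHom_comp_algebraMap_eq (homLeft (S := S) E) (homRight E)
    hE.isNilpotent_homLeft_sub_homRight
  have hρ' (a : R) : ρ (algebraMap R S a) = homRight E a := RingHom.congr_fun hρ a
  let ι : (U →ₗ[K] W) →+ U →+ W := LinearMap.toAddMonoidHom'
  let β : S →+ U →+ W := ι.comp ((homEval E).comp ρ.toAddMonoidHom)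
  have hβ (s : S) (u : U) : β s u = homEval E (ρ s) u := rfl
  have hbal (a : R) (s : S) (u : U) : β (a • s) u = β s (a • u) := by
    rw [hβ, hβ, Algebra.smul_def, map_mul, hρ', homEval_homRight_mul_apply]
  let D : S ⊗[R] U →ₗ[K] W :=
    { TensorProduct.liftAddHom β hbal with
      map_smul' k x := by
        change TensorProduct.liftAddHom β hbal (k • x) = k • TensorProduct.liftAddHom β hbal x
        induction x with
        | zero => simp
        | add x y hx hy => rw [smul_add, map_add, hx, hy, map_add, smul_add]
        | tmul s u =>
          -- `ρ` is not assumed `K`-linear: scalars from `K` pass through `R` to the factor `u`.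
          rw [TensorProduct.smul_tmul', ← algebraMap_smul R k s, TensorProduct.liftAddHom_tmul,
            TensorProduct.liftAddHom_tmul, hbal, algebraMap_smul, hβ, map_smul, hβ] }
  have hD (s : S) (u : U) : D (s ⊗ₜ u) = homEval E (ρ s) u :=
    TensorProduct.liftAddHom_tmul β hbal s u
  -- For fixed `s`, the operator `θ_s` on `D` corresponds to multiplication by `s ⊗ 1 - ρ(s)`.
  have hpow (s : S) (n : ℕ) (t : S) (u : U) : (diffTheta K (S ⊗[R] U) W s ^ n) D (t ⊗ₜ u) =
      homEval E ((homLeft E s - ρ s) ^ n * ρ t) u := by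
    induction n generalizing t with
    | zero => rw [pow_zero, pow_zero, one_mul, Module.End.one_apply, hD]
    | succ n ih =>
      rw [pow_succ', Module.End.mul_apply, diffTheta_apply, TensorProduct.smul_tmul', ih, ih,
        ← homEval_homLeft_mul_apply, ← LinearMap.sub_apply, ← map_sub, smul_eq_mul, map_mul]
      congr 2
      ring
  refine ⟨D, fun s => ?_, fun u => ?_⟩
  · obtain ⟨n, hn⟩ := isNilpotent_sub_of_isEpi (R := R) (homLeft E) ρ
      (fun a => by rw [hρ']; exact hE.isNilpotent_homLeft_sub_homRight a) s
    refine ⟨n, LinearMap.ext fun x => ?_⟩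
    induction x with
    | zero => rw [map_zero, map_zero]
    | add x y hx hy => rw [map_add, hx, hy, map_add]
    | tmul t u =>
      rw [hpow, pow_succ, hn, zero_mul, zero_mul, map_zero,
        LinearMap.zero_apply, LinearMap.zero_apply]
  · rw [hD, map_one, ← map_one (Ideal.Quotient.mk _), homEval_mk, map_one, Module.End.one_apply]

/-- In `(S ⊗[K] S) ⧸ Ann(D)` every `1 ⊗ s` is the class of some `c : S ⊗[K] R`. Hence `D(s ⊗ u)` is
the value of `c D` at `1 ⊗ u`, a combination of values of `D` at elements `1 ⊗ (a • u)`. -/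
theorem IsDiffOp.eq_zero_of_forall_one_tmul {U W : Type*}
    [AddCommGroup U] [Module R U] [AddCommGroup W] [Module K W] [Module S W] [IsScalarTower K S W]
    {D : S ⊗[R] U →ₗ[K] W} (hD : IsDiffOp S D) (h : ∀ u, D ((1 : S) ⊗ₜ[R] u) = 0) : D = 0 := by
  let j : S ⊗[K] R →ₐ[K] S ⊗[K] S :=
    Algebra.TensorProduct.map (AlgHom.id K S) (IsScalarTower.toAlgHom K R S)
  let p : S ⊗[K] R →+* S ⊗[K] S ⧸ homAnnihilator S S D :=
    (Ideal.Quotient.mk _).comp (j : S ⊗[K] R →+* S ⊗[K] S)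
  have hj (c : S ⊗[K] R) (u : U) :
      homAction K S S (S ⊗[R] U) W (j c) D ((1 : S) ⊗ₜ[R] u) = 0 := by
    induction c with
    | zero => simp
    | add x y hx hy => rw [map_add, map_add, LinearMap.add_apply, LinearMap.add_apply, hx, hy,
        add_zero]
    | tmul s a =>
      have : j (s ⊗ₜ a) = s ⊗ₜ algebraMap R S a := rfl
      rw [this, homAction_tmul_apply, algebraMap_smul, ← TensorProduct.tmul_smul, h, smul_zero]
  ext x
  induction x with
  | zero => simp
  | add x y hx hy => rw [map_add, hx, hy, map_add]
  | tmul s u =>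
    obtain ⟨c, hc⟩ := map_mem_subring_of_isEpi (R := R) p.range (homLeft D) (homRight D)
      (fun a => hD.isNilpotent_homLeft_sub_homRight _)
      (fun s => ⟨s ⊗ₜ 1, by simp [p, j, homLeft]⟩)
      (fun a => ⟨1 ⊗ₜ a, by simp [p, j, homRight]⟩) s
    have h1 := congrArg (fun x => homEval D x ((1 : S) ⊗ₜ[R] u)) hc
    have h2 : homEval D (homRight (S := S) D s) ((1 : S) ⊗ₜ[R] u) = D (s ⊗ₜ[R] u) := by
      refine (homAction_tmul_apply (1 : S) s D ((1 : S) ⊗ₜ[R] u)).trans ?_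
      rw [one_smul, TensorProduct.smul_tmul', smul_eq_mul, mul_one]
    rw [← h2, ← h1, LinearMap.zero_apply]
    exact hj c u

end FlatEpi

theorem mainTheorem2 {K R S U V : Type*} [CommRing K] [CommRing R] [CommRing S]
    [Algebra K R] [Algebra R S] [Algebra K S] [IsScalarTower K R S]
    [AddCommGroup U] [Module K U] [Module R U] [IsScalarTower K R U]
    [AddCommGroup V] [Module K V] [Module R V] [IsScalarTower K R V]
    [Module.Flat R S] [Algebra.IsEpi R S]
    (D : U →ₗ[K] V) (hD : IsDiffOp R D) :
    ∃! D' : S ⊗[R] U →ₗ[K] S ⊗[R] V,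
      IsDiffOp S D' ∧ ∀ u : U, D' ((1 : S) ⊗ₜ[R] u) = (1 : S) ⊗ₜ[R] D u := by
  have hE : IsDiffOp R ((TensorProduct.mk R S V 1).restrictScalars K ∘ₗ D) :=
    hD.comp_left _ fun a x => (TensorProduct.mk R S V 1).map_smul a x
  obtain ⟨D', hD', h⟩ := hE.exists_extension (S := S)
  refine ⟨D', ⟨hD', h⟩, fun D'' ⟨hD'', h'⟩ => sub_eq_zero.mp ?_⟩
  refine (hD''.sub hD').eq_zero_of_forall_one_tmul fun u => ?_
  rw [LinearMap.sub_apply, h', h, sub_eq_zero]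
  rfl
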